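/- Let $d\ge 0$ and let $g,g'\colon(\mathbb C^d,0)\to(\mathbb C,0)$ be germs of holomorphic functions. Assume that both are quasihomogeneous, where $g$ is called quasihomogeneous if there are positive integers $w_1,\dots,w_d$ (weights) and $w$ (degree) such that for every $\lambda\in\mathbb C$ $$g(\lambda^{w_1}z_1,\dots,\lambda^{w_d}z_d)=\lambda^{w}g(z_1,\dots,z_d)$$ as germs in $z$ at $0$ (the weights and degrees of $g$ and $g'$ may differ). Assume also that both have an isolated singularity, that is, $dg(z)\neq 0$ and $dg'(z)\ne 0$ for all $z\neq 0$ sufficiently close to $0$ (germs that are regular at $0$ are allowed). Then $g$ and $g'$ are $\mathscr K$-equivalent if and only if they are $\mathscr R$-equivalent. Here $g$ and $g'$ are $\mathscr R$-equivalent if $g=g'\circ\varphi$ for some germ of biholomorphism $\varphi\colon(\mathbb C^d,0)\to(\mathbb C^d,0)$. They are $\mathscr K$-equivalent if there is a germ of biholomorphism $\theta$ of $(\mathbb C^d\times\mathbb C,0)$ of the form $\theta(x,y)=(\varphi(x),\psi(x,y))$, where $\varphi$ is a germ of biholomorphism of $(\mathbb C^d,0)$ and $\psi(x,0)\equiv 0$,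 such that $(\varphi(x),g(\varphi(x)))=\theta(x,g'(x))$ for all $x$ near $0$. -/

import Mathlib

open Filter Topology

namespace HolGerm

/-- A function `g` represents a holomorphic function germ `(E, 0) → (ℂ, 0)`. -/
def IsFunctionGerm {E : Type*} [NormedAddCommGroup E] [NormedSpace ℂ E] (g : E → ℂ) : Prop :=
  AnalyticAt ℂ g 0 ∧ g 0 = 0

/-- `φ` represents a germ of diffeomorphism `(E, 0) → (E, 0)`: it is holomorphic near the origin,
fixes the origin, and has a two-sided holomorphic inverse as a germ at the origin. -/
def IsDiffeoGerm {E : Type*} [NormedAddCommGroup E] [NormedSpace ℂ E] (φ : E → E) : Prop :=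
  AnalyticAt ℂ φ 0 ∧ φ 0 = 0 ∧
    ∃ χ : E → E, AnalyticAt ℂ χ 0 ∧ χ 0 = 0 ∧
      (∀ᶠ x in 𝓝 0, χ (φ x) = x) ∧ (∀ᶠ x in 𝓝 0, φ (χ x) = x)

/-- The germ of `g` at the origin of `ℂ^d` is quasihomogeneous: for some positive integer weights
and some positive integer degree, `g (λ^{w₁} z₁, …, λ^{w_d} z_d) = λ^w g (z)` holds for each
`λ : ℂ`, as an equality of germs in `z` at the origin. -/
def IsQuasihomogeneous {d : ℕ} (g : (Fin d → ℂ) → ℂ) : Prop :=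
  ∃ (wt : Fin d → ℕ) (w : ℕ), (∀ i, 0 < wt i) ∧ 0 < w ∧
    ∀ l : ℂ, ∀ᶠ z in 𝓝 (0 : Fin d → ℂ), g (fun i => l ^ wt i * z i) = l ^ w * g z

/-- The origin is an isolated critical point of `g`: the differential of `g` does not vanish at
the points `z ≠ 0` close to the origin. (Germs that are regular at the origin are allowed.) -/
def HasIsolatedSingularity {d : ℕ} (g : (Fin d → ℂ) → ℂ) : Prop :=
  ∀ᶠ z in 𝓝[≠] (0 : Fin d → ℂ), fderiv ℂ g z ≠ 0

/-- Right equivalence: `g = g' ∘ φ` as germs, for a germ of diffeomorphism `φ` of the source. -/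
def REquiv {d : ℕ} (g g' : (Fin d → ℂ) → ℂ) : Prop :=
  ∃ φ : (Fin d → ℂ) → (Fin d → ℂ), IsDiffeoGerm φ ∧ ∀ᶠ x in 𝓝 0, g x = g' (φ x)

/-- Contact equivalence: there is a germ of diffeomorphism `θ (x, y) = (φ x, ψ (x, y))` of
`(ℂ^d × ℂ, 0)`, with `φ` a germ of diffeomorphism of `(ℂ^d, 0)` and `ψ (x, 0) = 0`, such that
`(φ x, g (φ x)) = θ (x, g' x)`. -/
def KEquiv {d : ℕ} (g g' : (Fin d → ℂ) → ℂ) : Prop :=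
  ∃ (θ : (Fin d → ℂ) × ℂ → (Fin d → ℂ) × ℂ) (φ : (Fin d → ℂ) → (Fin d → ℂ))
    (ψ : (Fin d → ℂ) × ℂ → ℂ),
    IsDiffeoGerm θ ∧ IsDiffeoGerm φ ∧
    (∀ᶠ p in 𝓝 0, θ p = (φ p.1, ψ p)) ∧
    (∀ᶠ x in 𝓝 0, ψ (x, 0) = 0) ∧
    (∀ᶠ x in 𝓝 0, (φ x, g (φ x)) = θ (x, g' x))

end HolGerm

/-! A contact equivalence preserves `y = 0`, so `ψ = y * v`, and invertibility of `θ` forces `v 0 ≠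
0`. Hence `g ∘ φ = u * g'` with the unit `u x = v (x, g' x)` (`KEquiv.exists_unit`).
Quasihomogeneity absorbs the unit: if `s ^ w = u`, rescaling `x i` by `s x ^ wt i` multiplies `g'`
by `u`. As `s x` varies with `x`, the scaling identity must hold uniformly in the parameter
(`eventually_quasihomogeneous`). The converse uses a product map. -/

namespace HolGerm

section Division

variable {E F : Type*} [NormedAddCommGroup E] [NormedSpace ℂ E]
  [NormedAddCommGroup F] [NormedSpace ℂ F]

/-- The average of an analytic function over a continuous path of contractions is analytic. -/
theorem analyticAt_intervalIntegral_comp_contraction [CompleteSpace F] {G : E → F}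
    (hG : AnalyticAt ℂ G 0) {L : ℝ → E →L[ℂ] E} (hL : Continuous L)
    (hL1 : ∀ t ∈ Set.uIoc (0 : ℝ) 1, ‖L t‖ ≤ 1) :
    AnalyticAt ℂ (fun v => ∫ t in (0 : ℝ)..1, G (L t v)) 0 := by
  obtain ⟨q, r, hq⟩ := hG
  have hcont : ∀ n, Continuous fun t => (q n).compContinuousLinearMap (fun _ : Fin n => L t) := by
    intro n
    have := (ContinuousMultilinearMap.compContinuousLinearMapContinuousMultilinear ℂ
      (fun _ : Fin n => E) (fun _ : Fin n => E) F).cont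
    have h2 : Continuous fun t => ContinuousMultilinearMap.compContinuousLinearMapContinuousMultilinear ℂ
      (fun _ : Fin n => E) (fun _ : Fin n => E) F (fun _ : Fin n => L t) :=
      this.comp (continuous_pi fun _ => hL)
    exact h2.clm_apply continuous_const
  have hbound : ∀ n, ∀ t ∈ Set.uIoc (0 : ℝ) 1,
      ‖(q n).compContinuousLinearMap (fun _ : Fin n => L t)‖ ≤ ‖q n‖ := by
    intro n t ht
    refine ((q n).norm_compContinuousLinearMap_le _).trans ?_
    refine mul_le_of_le_one_right (norm_nonneg _) ?_
    exact Finset.prod_le_one (fun _ _ => norm_nonneg _) (fun _ _ => hL1 t ht)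
  -- Integrate the power series termwise; contractions do not increase the coefficient norms, so the
  -- radius does not shrink.
  let s : FormalMultilinearSeries ℂ E F := fun n =>
    ∫ t in (0 : ℝ)..1, (q n).compContinuousLinearMap (fun _ : Fin n => L t)
  refine ⟨s, r, ?_, hq.r_pos, ?_⟩
  · refine hq.r_le.trans (FormalMultilinearSeries.radius_le_of_le fun n => ?_)
    simpa using intervalIntegral.norm_integral_le_of_norm_le_const (hbound n)
  · intro y hy
    have hs : ∀ n, s n (fun _ => y) = ∫ t in (0 : ℝ)..1, q n (fun _ => L t y) := by
      intro n
      have := (ContinuousMultilinearMap.apply ℂ (fun _ : Fin n => E) F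
        (fun _ => y)).intervalIntegral_comp_comm (a := 0) (b := 1)
        (μ := MeasureTheory.volume) ((hcont n).intervalIntegrable _ _)
      exact this.symm
    simp only [hs, zero_add]
    have hy' : (‖y‖₊ : ENNReal) < q.radius := by
      refine lt_of_lt_of_le ?_ hq.r_le
      simpa [Metric.mem_eball, edist_zero_right, enorm_eq_nnnorm] using hy
    have hsum : Summable fun n => ‖q n‖ * ‖y‖ ^ n := by
      simpa only [coe_nnnorm] using q.summable_norm_mul_pow hy'
    refine intervalIntegral.hasSum_integral_of_dominated_convergence
      (fun n _ => ‖q n‖ * ‖y‖ ^ n) ?_ ?_ ?_ ?_ ?_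
    · intro n
      exact ((ContinuousMultilinearMap.apply ℂ (fun _ : Fin n => E) F
        (fun _ => y)).continuous.comp (hcont n)).aestronglyMeasurable
    · refine fun n => Filter.Eventually.of_forall fun t ht => ?_
      exact (((q n).compContinuousLinearMap (fun _ : Fin n => L t)).le_opNorm_mul_pow_of_le
        (b := ‖y‖) ((pi_norm_const_le y))).trans
          (mul_le_mul_of_nonneg_right (hbound n t ht) (by positivity))
    · exact Filter.Eventually.of_forall fun _ _ => hsum
    · exact intervalIntegrable_const
    · refine Filter.Eventually.of_forall fun t ht => ?_
      have hLy : L t y ∈ Metric.eball (0 : E) r := by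
        rw [Metric.mem_eball, edist_zero_right] at hy ⊢
        refine lt_of_le_of_lt ?_ hy
        rw [enorm_le_iff_norm_le]
        simpa using (L t).le_of_opNorm_le (hL1 t ht) y
      simpa using hq.hasSum hLy

/-- An analytic germ on `E × ℂ` vanishing on `E × {0}` is divisible by the second coordinate, and
the quotient at the origin is the partial derivative. -/
theorem exists_analyticAt_eq_snd_mul {f : E × ℂ → ℂ} (hf : AnalyticAt ℂ f 0)
    (h0 : ∀ᶠ x in 𝓝 (0 : E), f (x, 0) = 0) :
    ∃ u : E × ℂ → ℂ, AnalyticAt ℂ u 0 ∧ u 0 = fderiv ℂ f 0 (0, 1) ∧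
      ∀ᶠ p in 𝓝 (0 : E × ℂ), f p = p.2 * u p := by
  let G : E × ℂ → ℂ := fun p => fderiv ℂ f p (0, 1)
  have hG : AnalyticAt ℂ G 0 := 
    ((ContinuousLinearMap.apply ℂ ℂ ((0, 1) : E × ℂ)).analyticAt _).comp hf.fderiv
  -- Hadamard's lemma: with `L t (x, y) = (x, t y)`, integrate `d/dt f (x, t y) = y * ∂f/∂y (x, t
  -- y)` over `[0, 1]`.
  let L : ℝ → E × ℂ →L[ℂ] E × ℂ := fun t =>
    (ContinuousLinearMap.fst ℂ E ℂ).prod ((t : ℂ) • ContinuousLinearMap.snd ℂ E ℂ)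
  have hLc : Continuous L := by
    have h1 : L = fun t : ℝ => (ContinuousLinearMap.inl ℂ E ℂ).comp (ContinuousLinearMap.fst ℂ E ℂ)
        + (t : ℂ) • (ContinuousLinearMap.inr ℂ E ℂ).comp (ContinuousLinearMap.snd ℂ E ℂ) := by
      funext t
      ext <;> simp [L]
    rw [h1]
    fun_prop
  have hLle : ∀ t ∈ Set.Icc (0 : ℝ) 1, ∀ p, ‖L t p‖ ≤ ‖p‖ := by
    intro t ht p
    rw [Prod.norm_def, Prod.norm_def]
    refine max_le_max le_rfl ?_
    have : ‖(t : ℂ)‖ ≤ 1 := by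
      rw [Complex.norm_real, Real.norm_eq_abs, abs_le]; constructor <;> linarith [ht.1, ht.2]
    simpa [L] using mul_le_mul_of_nonneg_right this (norm_nonneg p.2)
  refine ⟨fun p => ∫ t in (0 : ℝ)..1, G (L t p), ?_, ?_, ?_⟩
  · refine analyticAt_intervalIntegral_comp_contraction hG hLc fun t ht => ?_
    refine ContinuousLinearMap.opNorm_le_bound _ zero_le_one fun p => ?_
    rw [one_mul]
    exact hLle t (Set.Ioc_subset_Icc_self (by simpa using ht)) p
  · simp [G]
  · obtain ⟨ε, hε, hball⟩ := Metric.eventually_nhds_iff_ball.1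
      (hf.eventually_analyticAt.and hG.eventually_analyticAt)
    have h0' : ∀ᶠ p in 𝓝 (0 : E × ℂ), f (p.1, 0) = 0 := by
      have := continuous_fst.tendsto (0 : E × ℂ)
      exact this.eventually h0
    filter_upwards [h0', Metric.ball_mem_nhds _ hε] with p hp0 hp
    have hLp : ∀ t ∈ Set.uIcc (0 : ℝ) 1, L t p ∈ Metric.ball (0 : E × ℂ) ε := by
      intro t ht
      rw [mem_ball_zero_iff] at hp ⊢
      exact (hLle t (by simpa using ht) p).trans_lt hp
    have hpath : ∀ t : ℝ, HasDerivAt (fun t => L t p) (0, p.2) t := by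
      intro t
      have h2 : HasDerivAt (fun t : ℝ => (t : ℂ) * p.2) p.2 t := by
        simpa using (Complex.ofRealCLM.hasDerivAt (x := t)).mul_const p.2
      exact (hasDerivAt_const t p.1).prodMk h2
    have hderiv : ∀ t ∈ Set.uIcc (0 : ℝ) 1,
        HasDerivAt (fun t => f (L t p)) (p.2 * G (L t p)) t := by
      intro t ht
      have hd := ((hball _ (hLp t ht)).1.differentiableAt.hasFDerivAt.restrictScalars ℝ).comp_hasDerivAt
        t (hpath t)
      convert! hd using 1
      have : ((0, p.2) : E × ℂ) = p.2 • ((0, 1) : E × ℂ) := by simp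
      rw [ContinuousLinearMap.coe_restrictScalars', this, map_smul, smul_eq_mul]
    have hint : IntervalIntegrable (fun t => p.2 * G (L t p)) MeasureTheory.volume 0 1 := by
      refine ContinuousOn.intervalIntegrable fun t ht => ?_
      refine ContinuousAt.continuousWithinAt (continuousAt_const.mul ?_)
      exact ContinuousAt.comp' (f := fun t => L t p) (hball _ (hLp t ht)).2.continuousAt
        (hpath t).continuousAt
    have key := intervalIntegral.integral_eq_sub_of_hasDerivAt hderiv hint
    rw [intervalIntegral.integral_const_mul] at key
    rw [key]
    simp [L, hp0]

end Division

section Diffeo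

variable {E : Type*} [NormedAddCommGroup E] [NormedSpace ℂ E]

theorem IsDiffeoGerm.exists_inverse {φ : E → E} (h : IsDiffeoGerm φ) :
    ∃ χ, IsDiffeoGerm χ ∧ (∀ᶠ x in 𝓝 0, χ (φ x) = x) ∧ ∀ᶠ x in 𝓝 0, φ (χ x) = x := by
  obtain ⟨h1, h2, χ, h3, h4, h5, h6⟩ := h
  exact ⟨χ, ⟨h3, h4, φ, h1, h2, h6, h5⟩, h5, h6⟩

theorem IsDiffeoGerm.tendsto {φ : E → E} (h : IsDiffeoGerm φ) : Tendsto φ (𝓝 0) (𝓝 0) := by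
  simpa [h.2.1] using h.1.continuousAt.tendsto

theorem IsDiffeoGerm.comp {φ χ : E → E} (hφ : IsDiffeoGerm φ) (hχ : IsDiffeoGerm χ) :
    IsDiffeoGerm (φ ∘ χ) := by
  obtain ⟨φ', hφ', h1, h2⟩ := hφ.exists_inverse
  obtain ⟨χ', hχ', h3, h4⟩ := hχ.exists_inverse
  refine ⟨AnalyticAt.comp (by simpa [hχ.2.1] using hφ.1) hχ.1, by simp [hφ.2.1, hχ.2.1], χ' ∘ φ',
    AnalyticAt.comp (by simpa [hφ'.2.1] using hχ'.1) hφ'.1, by simp [hφ'.2.1, hχ'.2.1], ?_, ?_⟩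
  · filter_upwards [hχ.tendsto.eventually h1, h3] with x hx hx'
    simp [hx, hx']
  · filter_upwards [hφ'.tendsto.eventually h4, h2] with x hx hx'
    simp [hx, hx']

/-- The derivative at the origin of a germ of diffeomorphism is injective. -/
theorem IsDiffeoGerm.fderiv_injective {φ : E → E} (h : IsDiffeoGerm φ) :
    Function.Injective (fderiv ℂ φ 0) := by
  obtain ⟨χ, hχ, h1, -⟩ := h.exists_inverse
  have hχ' : HasFDerivAt χ (fderiv ℂ χ 0) (φ 0) := by
    rw [h.2.1]; exact hχ.1.differentiableAt.hasFDerivAt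
  have hid : (fderiv ℂ χ 0).comp (fderiv ℂ φ 0) = ContinuousLinearMap.id ℂ E :=
    (hχ'.comp 0 h.1.differentiableAt.hasFDerivAt).unique
      ((hasFDerivAt_id (𝕜 := ℂ) (0 : E)).congr_of_eventuallyEq h1)
  exact Function.LeftInverse.injective (g := fderiv ℂ χ 0) fun v => by
    simpa using DFunLike.congr_fun hid v

/-- The analytic inverse function theorem for germs. -/
theorem isDiffeoGerm_of_hasFDerivAt_equiv [CompleteSpace E] {φ : E → E} (h : AnalyticAt ℂ φ 0)
    (h0 : φ 0 = 0) (i : E ≃L[ℂ] E) (hi : HasFDerivAt φ (i : E →L[ℂ] E) 0) : IsDiffeoGerm φ := by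
  have hs : HasStrictFDerivAt φ (i : E →L[ℂ] E) 0 := hi.fderiv ▸ h.hasStrictFDerivAt
  have hsrc := hs.mem_toOpenPartialHomeomorph_source
  have hinv : (hs.toOpenPartialHomeomorph φ).symm 0 = 0 := by
    have := (hs.toOpenPartialHomeomorph φ).left_inv hsrc
    rwa [hs.toOpenPartialHomeomorph_coe, h0] at this
  refine ⟨h, h0, (hs.toOpenPartialHomeomorph φ).symm, ?_, hinv, ?_, ?_⟩
  · have := (hs.toOpenPartialHomeomorph φ).analyticAt_symm' hsrc (i := i)
      (by simpa using h) (by simpa using hi.fderiv)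
    simpa [h0] using this
  · simpa using (hs.toOpenPartialHomeomorph φ).eventually_left_inverse hsrc
  · have htgt := (hs.toOpenPartialHomeomorph φ).map_source hsrc
    have := (hs.toOpenPartialHomeomorph φ).eventually_right_inverse htgt
    simpa [h0] using this

end Diffeo

section Quasihomogeneous

variable {d : ℕ} {g g' : (Fin d → ℂ) → ℂ}

/-- Quasihomogeneity of a holomorphic germ holds locally uniformly in the scaling parameter. -/
theorem eventually_quasihomogeneous (hg : AnalyticAt ℂ g 0) {wt : Fin d → ℕ} {w : ℕ}
    (h : ∀ l : ℂ, ∀ᶠ z in 𝓝 (0 : Fin d → ℂ), g (fun i => l ^ wt i * z i) = l ^ w * g z) (c : ℂ) :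
    ∀ᶠ p in 𝓝 ((c, 0) : ℂ × (Fin d → ℂ)),
      g (fun i => p.1 ^ wt i * p.2 i) = p.1 ^ w * g p.2 := by
  have hA : Continuous fun p : ℂ × (Fin d → ℂ) => fun i => p.1 ^ wt i * p.2 i := by fun_prop
  have hA0 : Tendsto (fun p : ℂ × (Fin d → ℂ) => fun i => p.1 ^ wt i * p.2 i) (𝓝 (c, 0)) (𝓝 0) :=
    (hA.tendsto' _ _ (by ext; simp))
  have hev : ∀ᶠ p in 𝓝 ((c, 0) : ℂ × (Fin d → ℂ)),
      AnalyticAt ℂ g (fun i => p.1 ^ wt i * p.2 i) ∧ AnalyticAt ℂ g p.2 :=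
    (hA0.eventually hg.eventually_analyticAt).and
      ((continuous_snd.tendsto' _ _ rfl).eventually hg.eventually_analyticAt)
  obtain ⟨δ, hδ, hball⟩ := Metric.eventually_nhds_iff_ball.1 hev
  filter_upwards [Metric.ball_mem_nhds _ hδ] with p hp
  rw [← ball_prod_same] at hball hp
  -- For each parameter the identity is known only on some neighbourhood of `0`; the identity
  -- theorem extends it to a ball whose radius `δ` does not depend on the parameter.
  refine AnalyticOnNhd.eqOn_of_preconnected_of_eventuallyEq (𝕜 := ℂ)
    (f := fun z => g (fun i => p.1 ^ wt i * z i)) (g := fun z => p.1 ^ w * g z)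
    (U := Metric.ball 0 δ) ?_ ?_ (convex_ball _ _).isPreconnected (Metric.mem_ball_self hδ)
    (h p.1) hp.2
  · intro z hz
    refine AnalyticAt.fun_comp (f := fun z : Fin d → ℂ => fun i => p.1 ^ wt i * z i)
      (hball (p.1, z) ⟨hp.1, hz⟩).1 ?_
    exact AnalyticAt.pi fun i => analyticAt_const.mul
      ((ContinuousLinearMap.proj (R := ℂ) (φ := fun _ : Fin d => ℂ) i).analyticAt z)
  · intro z hz
    exact analyticAt_const.mul (hball (p.1, z) ⟨hp.1, hz⟩).2

/-- Weighted rescaling by a nowhere vanishing holomorphic function is a germ of diffeomorphism. -/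
theorem isDiffeoGerm_weighted_rescaling {s : (Fin d → ℂ) → ℂ} (hs : AnalyticAt ℂ s 0)
    (hs0 : s 0 ≠ 0) (wt : Fin d → ℕ) :
    IsDiffeoGerm fun x : Fin d → ℂ => fun i => s x ^ wt i * x i := by
  -- The derivative at `0` is diagonal: terms containing the derivative of `s` carry a factor `x i =
  -- 0`.
  let e : (Fin d → ℂ) ≃L[ℂ] (Fin d → ℂ) := ContinuousLinearEquiv.piCongrRight fun i =>
    ContinuousLinearEquiv.unitsEquivAut ℂ (Units.mk0 (s 0 ^ wt i) (pow_ne_zero _ hs0))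
  refine isDiffeoGerm_of_hasFDerivAt_equiv ?_ (by ext; simp) e ?_
  · exact AnalyticAt.pi fun i => (hs.pow _).mul
      ((ContinuousLinearMap.proj (R := ℂ) (φ := fun _ : Fin d => ℂ) i).analyticAt 0)
  · rw [hasFDerivAt_pi']
    intro i
    have h1 : HasFDerivAt (fun x : Fin d → ℂ => s x ^ wt i) _ 0 :=
      (hs.pow (wt i)).differentiableAt.hasFDerivAt
    have h2 := (ContinuousLinearMap.proj (R := ℂ) (φ := fun _ : Fin d => ℂ) i).hasFDerivAt
      (x := (0 : Fin d → ℂ))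
    refine (h1.mul h2).congr_fderiv ?_
    ext v
    simp [e, mul_comm]

/-- A holomorphic germ with nonzero value has a holomorphic `n`-th root. -/
theorem exists_analyticAt_pow_eq {E : Type*} [NormedAddCommGroup E] [NormedSpace ℂ E] {u : E → ℂ}
    {x₀ : E} (hu : AnalyticAt ℂ u x₀) (h0 : u x₀ ≠ 0) {n : ℕ} (hn : n ≠ 0) :
    ∃ s : E → ℂ, AnalyticAt ℂ s x₀ ∧ s x₀ ≠ 0 ∧ ∀ x, s x ^ n = u x := by
  have hn' : (n : ℂ)⁻¹ ≠ 0 := by simpa using hn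
  -- Normalising by `u x₀` puts the base near `1`, away from the branch cut.
  refine ⟨fun x => u x₀ ^ (n : ℂ)⁻¹ * (u x / u x₀) ^ (n : ℂ)⁻¹, ?_, by simp [h0], fun x => ?_⟩
  · refine analyticAt_const.mul (AnalyticAt.cpow (hu.div analyticAt_const h0) analyticAt_const ?_)
    simp [div_self h0]
  · rw [mul_pow, Complex.cpow_nat_inv_pow _ hn, Complex.cpow_nat_inv_pow _ hn,
      mul_div_cancel₀ _ h0]

/-- A quasihomogeneous germ is right equivalent to its product with any unit. -/
theorem IsQuasihomogeneous.exists_isDiffeoGerm_eq_mul (hg : AnalyticAt ℂ g 0)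
    (hq : IsQuasihomogeneous g) {u : (Fin d → ℂ) → ℂ} (hu : AnalyticAt ℂ u 0) (hu0 : u 0 ≠ 0) :
    ∃ φ, IsDiffeoGerm φ ∧ ∀ᶠ x in 𝓝 0, g (φ x) = u x * g x := by
  obtain ⟨wt, w, -, hw, hh⟩ := hq
  obtain ⟨s, hs, hs0, hsw⟩ := exists_analyticAt_pow_eq hu hu0 hw.ne'
  refine ⟨_, isDiffeoGerm_weighted_rescaling hs hs0 wt, ?_⟩
  have ht : Tendsto (fun x => (s x, x)) (𝓝 0) (𝓝 (s 0, (0 : Fin d → ℂ))) :=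
    hs.continuousAt.tendsto.prodMk_nhds tendsto_id
  filter_upwards [ht.eventually (eventually_quasihomogeneous hg hh (s 0))] with x hx
  rw [hx, hsw]

/-- Take `θ = χ × id` with `χ` inverse to `φ`, since `g ∘ χ = g'`. -/
theorem REquiv.kEquiv (h : REquiv g g') : KEquiv g g' := by
  obtain ⟨φ, hφ, h⟩ := h
  obtain ⟨χ, hχ, h1, h2⟩ := hφ.exists_inverse
  have hfst : AnalyticAt ℂ (Prod.fst : (Fin d → ℂ) × ℂ → Fin d → ℂ) 0 := analyticAt_fst
  have hsnd : AnalyticAt ℂ (Prod.snd : (Fin d → ℂ) × ℂ → ℂ) 0 := analyticAt_snd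
  have hfst0 : Tendsto (Prod.fst : (Fin d → ℂ) × ℂ → Fin d → ℂ) (𝓝 0) (𝓝 0) :=
    continuous_fst.tendsto _
  refine ⟨fun p => (χ p.1, p.2), χ, Prod.snd, ⟨?_, ?_, fun p => (φ p.1, p.2), ?_, ?_, ?_, ?_⟩, hχ,
    Eventually.of_forall fun _ => rfl, Eventually.of_forall fun _ => rfl, ?_⟩
  · exact (AnalyticAt.fun_comp (f := Prod.fst) hχ.1 hfst).prod hsnd
  · simp [hχ.2.1]
  · exact (AnalyticAt.fun_comp (f := Prod.fst) hφ.1 hfst).prod hsnd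
  · simp [hφ.2.1]
  · filter_upwards [hfst0.eventually h2] with p hp
    simp [hp]
  · filter_upwards [hfst0.eventually h1] with p hp
    simp [hp]
  · filter_upwards [hχ.tendsto.eventually h, h2] with x hx hx'
    rw [hx, hx']

/-- Contact equivalent germs agree up to a change of coordinates and a unit factor. -/
theorem KEquiv.exists_unit (hg' : IsFunctionGerm g') (h : KEquiv g g') :
    ∃ (φ : (Fin d → ℂ) → (Fin d → ℂ)) (u : (Fin d → ℂ) → ℂ), IsDiffeoGerm φ ∧ AnalyticAt ℂ u 0 ∧
      u 0 ≠ 0 ∧ ∀ᶠ x in 𝓝 0, g (φ x) = u x * g' x := by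
  obtain ⟨θ, φ, ψ, hθ, hφ, hθψ, hψ0, heq⟩ := h
  have hθ2 : (fun p => (θ p).2) =ᶠ[𝓝 0] ψ := hθψ.mono fun p hp => by simp [hp]
  have hψ : AnalyticAt ℂ ψ 0 := (AnalyticAt.fun_comp analyticAt_snd hθ.1).congr hθ2
  obtain ⟨v, hv, hv0, hψv⟩ := exists_analyticAt_eq_snd_mul hψ hψ0
  have hpair : AnalyticAt ℂ (fun x => (x, g' x)) (0 : Fin d → ℂ) := analyticAt_id.prod hg'.1
  have hpair0 : ((0 : Fin d → ℂ), g' 0) = 0 := by simp [hg'.2]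
  have htend : Tendsto (fun x => (x, g' x)) (𝓝 (0 : Fin d → ℂ)) (𝓝 0) := by
    simpa only [hpair0] using hpair.continuousAt.tendsto
  refine ⟨φ, fun x => v (x, g' x), hφ, ?_, ?_, ?_⟩
  · exact AnalyticAt.fun_comp (f := fun x => (x, g' x)) (by simpa only [hpair0] using hv) hpair
  · simp only [hpair0, hv0]
    -- If `∂ψ/∂y` vanished at `0`, then `(0, 1)` would lie in the kernel of the derivative of `θ`.
    intro hzero
    have hder : HasFDerivAt θ (((fderiv ℂ φ 0).comp (ContinuousLinearMap.fst ℂ _ ℂ)).prod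
        (fderiv ℂ ψ 0)) 0 := by
      refine HasFDerivAt.congr_of_eventuallyEq (HasFDerivAt.prodMk ?_ ?_) hθψ
      · exact HasFDerivAt.comp (f := Prod.fst) (0 : (Fin d → ℂ) × ℂ)
          hφ.1.differentiableAt.hasFDerivAt hasFDerivAt_fst
      · exact hψ.differentiableAt.hasFDerivAt
    have hker : fderiv ℂ θ 0 (0, 1) = fderiv ℂ θ 0 0 := by
      rw [hder.fderiv]
      simp [hzero]
    simpa using congrArg Prod.snd (hθ.fderiv_injective hker)
  · filter_upwards [heq, htend.eventually hθψ, htend.eventually hψv] with x h1 h2 h3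
    rw [h2, h3, Prod.mk.injEq] at h1
    rw [h1.2, mul_comm]

theorem KEquiv.rEquiv (hg' : IsFunctionGerm g') (hq' : IsQuasihomogeneous g') (h : KEquiv g g') :
    REquiv g g' := by
  obtain ⟨φ, u, hφ, hu, hu0, h1⟩ := h.exists_unit hg'
  obtain ⟨Φ, hΦ, h2⟩ := hq'.exists_isDiffeoGerm_eq_mul hg'.1 hu hu0
  obtain ⟨χ, hχ, -, h3⟩ := hφ.exists_inverse
  refine ⟨Φ ∘ χ, hΦ.comp hχ, ?_⟩
  filter_upwards [hχ.tendsto.eventually h1, hχ.tendsto.eventually h2, h3] with x a b c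
  rw [Function.comp_apply, b, ← a, c]

end Quasihomogeneous

end HolGerm

theorem mainTheorem12 (d : ℕ) (g g' : (Fin d → ℂ) → ℂ)
    (hg : HolGerm.IsFunctionGerm g) (hg' : HolGerm.IsFunctionGerm g')
    (hq : HolGerm.IsQuasihomogeneous g) (hq' : HolGerm.IsQuasihomogeneous g')
    (hs : HolGerm.HasIsolatedSingularity g) (hs' : HolGerm.HasIsolatedSingularity g') :
    HolGerm.KEquiv g g' ↔ HolGerm.REquiv g g' :=
  ⟨fun h => h.rEquiv hg' hq', fun h => h.kEquiv⟩
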